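/- Let $G$ be a finite graph with vertex set $V$. A pebbling configuration on $G$ is a function $f:V\to\{0,1,2,\dots\}$; it contains $\sum_{v\in V} f(v)$ pebbles. A pebbling move removes two pebbles from a vertex and places one pebble at an adjacent vertex. The configuration $f$ pebbles $G$ if for every vertex $v$ there is a (possibly empty) sequence of pebbling moves, starting from $f$, that brings a pebble to $v$. The optimal pebbling number $\pi^*(G)$ is the least $p$ such that some configuration containing $p$ pebbles pebbles $G$. Let $T^h$ be the complete binary tree of height $h$: the rooted tree in which every non-leaf vertex has exactly two children and every leaf is at distance $h$ from the root. Define lists of integers by $A_1=\{5\}$ and, for $k\ge 2$, let $A_k$ be the concatenation of $A_{k-1}$, $A_{k-1}$ and $\{1\}$, in this order. Each $A_k$ is an initial segment of $A_{k+1}$; let $a_n$ ($n\ge1$) be the $n$th element of the limit list, let $a_0=0$, and let $s_n=a_0+a_1+\cdots+a_n$. For a positive integer $h$ let $k(h)=\max\{k : s_k\le 2^h\}$. **Theorem.** For every positive integer $h$, $\pi^*(T^h)\ge 2^h-k(h)$. -/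

import Mathlib

namespace Pebbling

/-! ### Pebbling on a graph -/

section Graph

variable {V : Type*}

/-- `Move G f g`: the configuration `g` arises from `f` by one pebbling move, which removes two
pebbles from a vertex `u` and places one pebble at an adjacent vertex `v`. -/
def Move (G : SimpleGraph V) (f g : V → ℕ) : Prop :=
  ∃ u v : V, G.Adj u v ∧ f u = g u + 2 ∧ g v = f v + 1 ∧ ∀ w : V, w ≠ u → w ≠ v → g w = f w

/-- The configuration `f` pebbles `G`: for every vertex `v`, some (possibly empty) sequence of
pebbling moves starting from `f` brings a pebble to `v`. -/
def Pebbles (G : SimpleGraph V) (f : V → ℕ) : Prop :=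
  ∀ v : V, ∃ g : V → ℕ, Relation.ReflTransGen (Move G) f g ∧ 1 ≤ g v

/-- The optimal pebbling number: the least `p` such that some configuration of `p` pebbles
pebbles `G`. -/
noncomputable def optimalPebblingNumber [Fintype V] (G : SimpleGraph V) : ℕ :=
  sInf {p : ℕ | ∃ f : V → ℕ, ∑ v, f v = p ∧ Pebbles G f}

end Graph

/-! ### The complete binary tree -/

/-- Vertices of the complete binary tree of height `h`: binary words of length at most `h`. The
empty word is the root, the length of a word is its level, and the two children of a word `l`
of length less than `h` are `l ++ [false]` and `l ++ [true]`. -/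
def TreeVertex (h : ℕ) : Type := {l : List Bool // l.length ≤ h}

noncomputable instance (h : ℕ) : Fintype (TreeVertex h) :=
  (List.finite_length_le Bool h).fintype

/-- `IsChild v u`: the vertex `v` is a child of the vertex `u`. -/
def IsChild {h : ℕ} (v u : TreeVertex h) : Prop :=
  ∃ b : Bool, v.val = u.val ++ [b]

/-- The complete binary tree of height `h`. -/
def completeBinaryTree (h : ℕ) : SimpleGraph (TreeVertex h) where
  Adj u v := IsChild v u ∨ IsChild u v
  symm := ⟨fun _ _ huv => huv.symm⟩
  loopless := ⟨fun u hu => by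
    rcases hu with ⟨b, hb⟩ | ⟨b, hb⟩ <;> simpa using congrArg List.length hb⟩

/-! ### The sequence of ones and fives -/

/-- The lists `A_1 = {5}` and `A_k = join[A_{k-1}, A_{k-1}, {1}]` for `k ≥ 2`
(the value at `0` is a placeholder). -/
def listA : ℕ → List ℕ
  | 0 => []
  | 1 => [5]
  | k + 2 => listA (k + 1) ++ listA (k + 1) ++ [1]

/-- The `n`th element, counted from one, of the limit of the lists `A_k`, with `a_0 = 0`. Each list
is a prefix of the next one and `A_n` has at least `n` elements, so this is the `n`th element of
`A_n`; see `seqA_eq`. -/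
def seqA : ℕ → ℕ
  | 0 => 0
  | n + 1 => (listA (n + 1)).getD n 0

/-- The partial sums `s_n = a_0 + a_1 + ⋯ + a_n`. -/
def seqS (n : ℕ) : ℕ := ∑ i ∈ Finset.range (n + 1), seqA i

/-- `k(h) = max {k : s_k ≤ 2^h}`; the maximum exists, see `isGreatest_kNumber`. -/
noncomputable def kNumber (h : ℕ) : ℕ := sSup {k : ℕ | seqS k ≤ 2 ^ h}

theorem listA_prefix_succ (k : ℕ) : listA k <+: listA (k + 1) := by
  cases k with
  | zero => exact List.nil_prefix
  | succ k => exact ⟨listA (k + 1) ++ [1], by simp [listA]⟩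

theorem listA_prefix {j k : ℕ} (hjk : j ≤ k) : listA j <+: listA k := by
  induction k, hjk using Nat.le_induction with
  | base => exact List.prefix_refl _
  | succ k _ ih => exact ih.trans (listA_prefix_succ k)

theorem le_length_listA (k : ℕ) : k ≤ (listA k).length := by
  induction k with
  | zero => exact Nat.zero_le _
  | succ k ih =>
    cases k with
    | zero => simp [listA]
    | succ k => simp only [listA, List.length_append, List.length_singleton]; omega

theorem seqA_eq {n k : ℕ} (hn : n < (listA k).length) : seqA (n + 1) = (listA k)[n] := by
  have h1 : n < (listA (n + 1)).length := le_length_listA (n + 1)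
  simp only [seqA, List.getD_eq_getElem _ _ h1]
  rcases le_total (n + 1) k with h | h
  · exact (listA_prefix h).getElem h1
  · exact ((listA_prefix h).getElem hn).symm

theorem one_le_of_mem_listA (k : ℕ) : ∀ a ∈ listA k, 1 ≤ a := by
  induction k with
  | zero => simp [listA]
  | succ k ih =>
    cases k with
    | zero => simp [listA]
    | succ k =>
      intro a ha
      simp only [listA, List.mem_append, List.mem_singleton] at ha
      rcases ha with (ha | ha) | ha
      · exact ih a ha
      · exact ih a ha
      · exact ha.ge

theorem le_seqS (n : ℕ) : n ≤ seqS n := by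
  induction n with
  | zero => exact Nat.zero_le _
  | succ n ih =>
    have h1 : n < (listA (n + 1)).length := le_length_listA (n + 1)
    have h2 : 1 ≤ seqA (n + 1) := by
      rw [seqA_eq h1]
      exact one_le_of_mem_listA _ _ (List.getElem_mem h1)
    unfold seqS at ih ⊢
    rw [Finset.sum_range_succ]
    omega

theorem isGreatest_kNumber (h : ℕ) : IsGreatest {k : ℕ | seqS k ≤ 2 ^ h} (kNumber h) := by
  have hb : BddAbove {k : ℕ | seqS k ≤ 2 ^ h} := ⟨2 ^ h, fun k hk => (le_seqS k).trans hk⟩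
  have hne : {k : ℕ | seqS k ≤ 2 ^ h}.Nonempty := ⟨0, by simp [seqS, seqA]⟩
  exact ⟨Nat.sSup_mem hne hb, fun k hk => le_csSup hb hk⟩

end Pebbling

namespace Pebbling

/-! ### Number of ones in the binary expansion -/

/-! Along a path to a target, greedy collection gives a potential `reach` that no move increases
(`WordMove.reach_le`) and that bounds the pebbles on the target. So in a configuration that pebbles
the tree, every leaf has positive `reach`.

Induction on height (`le_three_mul_total`), with a supply at the root as an extra parameter, turns
this into `2 * 2 ^ h + 2 * bitCount (n / 2) ≤ 3 * n` for `n` pebbles. The companion bound on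
`collect` is carried along because each subtree supplies its sibling; the binary ones record
rounding losses.

With `k = 2 ^ h - n` and `b = (3 * n - 2 * 2 ^ h) / 2`, the sum `k + b` is `n / 2`, so `bitCount (k
+ b) ≤ b`. Then `seqS_le_of_bitCount_le` gives `s_k ≤ 3 * k + 2 * b ≤ 2 ^ h`, that is, `k ≤ k(h)`.
-/

/-- The number of ones in the binary expansion of `n`. -/
def bitCount (n : ℕ) : ℕ := (Nat.digits 2 n).sum

theorem bitCount_div_two (n : ℕ) : bitCount n = n % 2 + bitCount (n / 2) := by
  rcases Nat.eq_zero_or_pos n with rfl | hn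
  · simp [bitCount]
  · simp [bitCount, Nat.digits_def' one_lt_two hn]

theorem bitCount_pos {n : ℕ} (hn : 0 < n) : 0 < bitCount n := by
  induction n using Nat.strong_induction_on with
  | _ n ih =>
    rw [bitCount_div_two]
    rcases Nat.eq_zero_or_pos (n / 2) with h | h
    · omega
    · have := ih (n / 2) (by omega) h
      omega

theorem bitCount_succ_le (n : ℕ) : bitCount (n + 1) ≤ bitCount n + 1 := by
  induction n using Nat.strong_induction_on with
  | _ n ih =>
    rw [bitCount_div_two (n + 1), bitCount_div_two n]
    rcases Nat.even_or_odd' n with ⟨m, rfl | rfl⟩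
    · rw [show (2 * m + 1) / 2 = 2 * m / 2 by omega]
      omega
    · have h := ih m (by omega)
      rw [show (2 * m + 1 + 1) / 2 = m + 1 by omega, show (2 * m + 1) / 2 = m by omega]
      omega

theorem bitCount_add_le (n c : ℕ) : bitCount (n + c) ≤ bitCount n + c := by
  induction c with
  | zero => simp
  | succ c ih =>
    have := bitCount_succ_le (n + c)
    rw [← add_assoc]
    omega

theorem bitCount_two_pow_add {i m : ℕ} (hm : m < 2 ^ i) :
    bitCount (2 ^ i + m) = bitCount m + 1 := by
  induction i generalizing m with
  | zero =>
    obtain rfl : m = 0 := by simpa using hm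
    simp [bitCount]
  | succ i ih =>
    rw [pow_succ] at hm ⊢
    rw [bitCount_div_two (2 ^ i * 2 + m), bitCount_div_two m,
      show (2 ^ i * 2 + m) / 2 = 2 ^ i + m / 2 by omega, ih (by omega)]
    omega

/-! ### The partial sums of the sequence of ones and fives -/

theorem length_listA (k : ℕ) : (listA k).length + 1 = 2 ^ k := by
  induction k with
  | zero => simp [listA]
  | succ k ih =>
    cases k with
    | zero => simp [listA]
    | succ k =>
      simp only [listA, List.length_append, List.length_singleton, pow_succ] at ih ⊢
      omega

theorem sum_listA (k : ℕ) : (listA (k + 1)).sum + 1 = 3 * 2 ^ (k + 1) := by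
  induction k with
  | zero => simp [listA]
  | succ k ih =>
    simp only [listA, List.sum_append, List.sum_singleton, pow_succ] at ih ⊢
    omega

theorem seqS_succ (n : ℕ) : seqS (n + 1) = seqS n + seqA (n + 1) :=
  Finset.sum_range_succ _ _

theorem seqS_eq_sum_take {n k : ℕ} (hn : n ≤ (listA k).length) :
    seqS n = ((listA k).take n).sum := by
  induction n with
  | zero => simp [seqS, seqA]
  | succ n ih =>
    rw [seqS_succ, ih (by omega), seqA_eq (k := k) (by omega), List.sum_take_succ _ _ (by omega)]

theorem seqS_two_pow_sub_one (i : ℕ) : seqS (2 ^ (i + 1) - 1) + 1 = 3 * 2 ^ (i + 1) := by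
  have h := length_listA (i + 1)
  rw [show 2 ^ (i + 1) - 1 = (listA (i + 1)).length by omega, seqS_eq_sum_take le_rfl,
    List.take_length, sum_listA]

/-- After its first block `A_{i+1}` the sequence repeats that block, so the sum restarts. -/
theorem seqS_two_pow_sub_one_add {i r : ℕ} (hr : r < 2 ^ (i + 1)) :
    seqS (2 ^ (i + 1) - 1 + r) = seqS (2 ^ (i + 1) - 1) + seqS r := by
  have h := length_listA (i + 1)
  have h' := length_listA (i + 2)
  have hp : 2 ^ (i + 2) = 2 ^ (i + 1) * 2 := pow_succ 2 (i + 1)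
  rw [show 2 ^ (i + 1) - 1 = (listA (i + 1)).length by omega,
    seqS_eq_sum_take (k := i + 2) (by omega), seqS_eq_sum_take (n := r) (k := i + 1) (by omega),
    seqS_eq_sum_take (k := i + 1) le_rfl, List.take_length]
  simp only [listA, List.append_assoc, List.take_length_add_append, List.sum_append]
  rw [List.take_append_of_le_length (by omega)]

theorem seqS_add_le (n d : ℕ) : seqS n + d ≤ seqS (n + d) := by
  induction d with
  | zero => simp
  | succ d ih =>
    have h1 : n + d < (listA (n + d + 1)).length := le_length_listA _
    have h2 : 1 ≤ seqA (n + d + 1) := by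
      rw [seqA_eq h1]
      exact one_le_of_mem_listA _ _ (List.getElem_mem h1)
    rw [← add_assoc n, seqS_succ]
    omega

/-- If `k` is a sum of `b` numbers of the form `2 ^ i - 1`, then `s_k ≤ 3 k + 2 b`. The hypothesis
says that `k + b` is a sum of `b` powers of two. -/
theorem seqS_le_of_bitCount_le {k b : ℕ} (hb : bitCount (k + b) ≤ b) :
    seqS k ≤ 3 * k + 2 * b := by
  induction k using Nat.strong_induction_on generalizing b with
  | _ k ih =>
    rcases Nat.eq_zero_or_pos k with rfl | hk
    · simp [seqS, seqA]
    have hb0 : 0 < b := lt_of_lt_of_le (bitCount_pos (by omega)) hb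
    obtain ⟨i, hi⟩ : ∃ i, Nat.log 2 (k + 1) = i + 1 :=
      Nat.exists_eq_succ_of_ne_zero (Nat.log_pos one_lt_two (by omega)).ne'
    have h1 : 2 ^ (i + 1) ≤ k + 1 := hi ▸ Nat.pow_log_le_self 2 (by omega)
    have h2 : k + 1 < 2 ^ (i + 1 + 1) := hi ▸ Nat.lt_pow_succ_log_self one_lt_two _
    have hpos : 2 ≤ 2 ^ (i + 1) := by
      rw [pow_succ]
      have := Nat.one_le_two_pow (n := i)
      omega
    rw [pow_succ 2 (i + 1)] at h2
    obtain ⟨r, rfl⟩ : ∃ r, k = 2 ^ (i + 1) - 1 + r := ⟨k + 1 - 2 ^ (i + 1), by omega⟩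
    have hs := seqS_two_pow_sub_one i
    rw [seqS_two_pow_sub_one_add (by omega)]
    -- If true, `2 ^ (i + 1)` is the leading bit of `k + b` and can be peeled off. Otherwise `b` is
    -- so large that it suffices to bound `s_r` by dropping terms, each at least one, from the full
    -- block sum.
    by_cases hc : r + (b - 1) < 2 ^ (i + 1)
    · rw [show 2 ^ (i + 1) - 1 + r + b = 2 ^ (i + 1) + (r + (b - 1)) by omega,
        bitCount_two_pow_add hc] at hb
      have := ih r (by omega) (b := b - 1) (by omega)
      omega
    · have := seqS_add_le r (2 ^ (i + 1) - 1 - r)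
      rw [show r + (2 ^ (i + 1) - 1 - r) = 2 ^ (i + 1) - 1 by omega] at this
      omega

/-! ### Configurations on binary words -/

/-- The number of pebbles of `f` on words of length at most `j`. -/
def total : ℕ → (List Bool → ℕ) → ℕ
  | 0, f => f []
  | j + 1, f => f [] + total j (fun l => f (false :: l)) + total j (fun l => f (true :: l))

/-- The number of pebbles that can be collected at the root of the tree of height `j`. -/
def collect : ℕ → (List Bool → ℕ) → ℕ
  | 0, f => f []
  | j + 1, f =>
    f [] + collect j (fun l => f (false :: l)) / 2 + collect j (fun l => f (true :: l)) / 2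

/-- The number of pebbles that can be brought to the vertex `v` of the tree of height `j` when `s`
additional pebbles are supplied at the root. -/
def reach : List Bool → ℕ → ℕ → (List Bool → ℕ) → ℕ
  | [], j, s, f => s + collect j f
  | _ :: _, 0, _, _ => 0
  | b :: v, j + 1, s, f =>
    reach v j ((s + f [] + collect j (fun l => f ((!b) :: l)) / 2) / 2) (fun l => f (b :: l))

theorem collect_succ (b : Bool) (j : ℕ) (f : List Bool → ℕ) :
    collect (j + 1) f =
      f [] + collect j (fun l => f (b :: l)) / 2 + collect j (fun l => f ((!b) :: l)) / 2 := by
  cases b <;> simp only [collect, Bool.not_false, Bool.not_true]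
  omega

theorem collect_root_le (j : ℕ) (f : List Bool → ℕ) : f [] ≤ collect j f := by
  cases j <;> simp only [collect] <;> omega

theorem collect_congr_off_root {j : ℕ} {f g : List Bool → ℕ} (hfg : ∀ w, w ≠ [] → g w = f w) :
    collect j g + f [] = collect j f + g [] := by
  cases j with
  | zero => simp only [collect]; omega
  | succ j =>
    have hc (b : Bool) : (fun l => g (b :: l)) = fun l => f (b :: l) :=
      funext fun l => hfg _ (List.cons_ne_nil _ _)
    simp only [collect, hc]
    omega

/-- Pebbles at the root and supplied pebbles are interchangeable: only their sum enters. -/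
theorem reach_congr_off_root {j s t : ℕ} {f g : List Bool → ℕ} (v : List Bool)
    (hfg : ∀ w, w ≠ [] → g w = f w) (hst : s + g [] = t + f []) :
    reach v j s g = reach v j t f := by
  cases v with
  | nil =>
    have := collect_congr_off_root (j := j) hfg
    simp only [reach]
    omega
  | cons b v =>
    cases j with
    | zero => rfl
    | succ j =>
      have hc (b : Bool) : (fun l => g (b :: l)) = fun l => f (b :: l) :=
        funext fun l => hfg _ (List.cons_ne_nil _ _)
      simp only [reach, hc, hst]

theorem reach_mono_supply {j s t : ℕ} (v : List Bool) (f : List Bool → ℕ) (hst : s ≤ t) :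
    reach v j s f ≤ reach v j t f := by
  induction v generalizing j s t f with
  | nil => simp only [reach]; omega
  | cons b v ih =>
    cases j with
    | zero => rfl
    | succ j => exact ih _ (Nat.div_le_div_right (by omega))

theorem le_reach {j : ℕ} (v : List Bool) (s : ℕ) (f : List Bool → ℕ) (hv : v.length ≤ j) :
    f v ≤ reach v j s f := by
  induction v generalizing j s f with
  | nil =>
    have := collect_root_le j f
    simp only [reach]
    omega
  | cons b v ih =>
    cases j with
    | zero => simp at hv
    | succ j => exact ih _ (fun l => f (b :: l)) (by simpa using hv)

/-! ### Pebbling moves on binary words -/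

/-- `WordMove j f g`: the configuration `g` arises from `f` by a pebbling move along an edge of the
complete binary tree of height `j`. -/
def WordMove (j : ℕ) (f g : List Bool → ℕ) : Prop :=
  ∃ (u : List Bool) (c : Bool), u.length < j ∧
    ((f u = g u + 2 ∧ g (u ++ [c]) = f (u ++ [c]) + 1) ∨
      (f (u ++ [c]) = g (u ++ [c]) + 2 ∧ g u = f u + 1)) ∧
    ∀ w, w ≠ u → w ≠ u ++ [c] → g w = f w

/-- A move either uses an edge between the root and a child, or takes place below a child. -/
theorem WordMove.cases_root {j : ℕ} {f g : List Bool → ℕ} (h : WordMove (j + 1) f g) :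
    ∃ b : Bool, (fun l => g ((!b) :: l)) = (fun l => f ((!b) :: l)) ∧
      ((g [] = f [] ∧ WordMove j (fun l => f (b :: l)) (fun l => g (b :: l))) ∨
        ((∀ w, w ≠ [] → g (b :: w) = f (b :: w)) ∧
          ((f [] = g [] + 2 ∧ g [b] = f [b] + 1) ∨ (f [b] = g [b] + 2 ∧ g [] = f [] + 1)))) := by
  obtain ⟨u, c, hu, hmove, hrest⟩ := h
  cases u with
  | nil =>
    refine ⟨c, funext fun l => hrest _ (by simp) (by simp), Or.inr ⟨fun w hw => ?_, hmove⟩⟩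
    exact hrest _ (by simp) (by simpa using hw)
  | cons b u =>
    refine ⟨b, funext fun l => hrest _ (by simp) (by simp), Or.inl ⟨hrest _ (by simp) (by simp),
      u, c, by simpa using hu, hmove, fun w hw hw' => hrest _ (by simpa using hw) ?_⟩⟩
    simpa using hw'

theorem WordMove.collect_le {j : ℕ} {f g : List Bool → ℕ} (h : WordMove j f g) :
    collect j g ≤ collect j f := by
  induction j generalizing f g with
  | zero =>
    obtain ⟨u, c, hu, -⟩ := h
    simp at hu
  | succ j ih =>
    obtain ⟨b, hother, ⟨hroot, hin⟩ | ⟨hoff, hedge⟩⟩ := h.cases_root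
    · have := ih hin
      rw [collect_succ b, collect_succ b j f, hother, hroot]
      omega
    · have := collect_congr_off_root (j := j) (f := fun l => f (b :: l))
        (g := fun l => g (b :: l)) hoff
      rw [collect_succ b, collect_succ b j f, hother]
      omega

theorem WordMove.reach_le {j : ℕ} {f g : List Bool → ℕ} (h : WordMove j f g) (v : List Bool)
    (s : ℕ) : reach v j s g ≤ reach v j s f := by
  induction j generalizing f g v s with
  | zero =>
    obtain ⟨u, c, hu, -⟩ := h
    simp at hu
  | succ j ih =>
    cases v with
    | nil =>
      have := h.collect_le
      simp only [reach]
      omega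
    | cons a v =>
      simp only [reach]
      obtain ⟨b, hother, hcase⟩ := h.cases_root
      obtain rfl | rfl : a = b ∨ a = !b := by cases a <;> cases b <;> simp
      · rw [hother]
        rcases hcase with ⟨hroot, hin⟩ | ⟨hoff, hedge⟩
        · rw [hroot]
          exact ih hin _ _
        · set x := collect j (fun l => f ((!a) :: l)) / 2
          rcases hedge with ⟨h1, h2⟩ | ⟨h1, h2⟩
          · refine (reach_congr_off_root v hoff ?_).le
            omega
          -- The extra root pebble raises the halved supply by at most one; the `2` restores the
          -- pebbles that left the child.
          · refine le_trans (reach_mono_supply (t := (s + f [] + x) / 2 + 2) v _ (by omega)) ?_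
            exact (reach_congr_off_root v hoff (by omega)).le
      · rw [hother, Bool.not_not]
        refine reach_mono_supply v _ (Nat.div_le_div_right ?_)
        rcases hcase with ⟨hroot, hin⟩ | ⟨hoff, hedge⟩
        · have := hin.collect_le
          omega
        · have := collect_congr_off_root (j := j) (f := fun l => f (b :: l))
            (g := fun l => g (b :: l)) hoff
          omega

/-! ### The lower bound on the number of pebbles -/

/-- Joining two subtrees, of which the first one, with the unprimed data, has at most as many pebbles
as the second one. -/
theorem join_subtrees {m s r d d' n n' p : ℕ} (hle : n ≤ n')
    (h : 2 * m + d ≤ 3 * n + 2 * ((s + r + d' / 2) / 2))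
    (h' : 2 * m + d' ≤ 3 * n' + 2 * ((s + r + d / 2) / 2))
    (hp : 2 * m + 2 * p ≤ 3 * n + 2 * ((s + r + d' / 2) / 2)) :
    4 * m + 2 * (p + n % 2 + (r + n' - n) / 2) ≤ 3 * (r + n + n') + 2 * s := by
  obtain ⟨c, rfl⟩ := Nat.exists_eq_add_of_le hle
  obtain ⟨u, hu⟩ : ∃ u, (s + r + d' / 2) / 2 = u := ⟨_, rfl⟩
  obtain ⟨u', hu'⟩ : ∃ u', (s + r + d / 2) / 2 = u' := ⟨_, rfl⟩
  rw [hu] at h hp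
  rw [hu'] at h'
  obtain ⟨x, e, he, rfl⟩ : ∃ x e, e < 2 ∧ d = 2 * x + e := ⟨d / 2, d % 2, by omega, by omega⟩
  obtain ⟨x', e', he', rfl⟩ : ∃ x e, e < 2 ∧ d' = 2 * x + e := ⟨d' / 2, d' % 2, by omega, by omega⟩
  obtain ⟨y, hy, hsy⟩ : ∃ y, y < 2 ∧ s + r + x' = 2 * u + y := ⟨(s + r + x') % 2, by omega, by omega⟩
  obtain ⟨y', hy', hsy'⟩ : ∃ y, y < 2 ∧ s + r + x = 2 * u' + y :=
    ⟨(s + r + x) % 2, by omega, by omega⟩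
  clear hu hu'
  rw [show r + (n + c) - n = r + c by omega]
  obtain ⟨a, ha⟩ := Nat.exists_eq_add_of_le h
  obtain ⟨a', ha'⟩ := Nat.exists_eq_add_of_le h'
  -- Eliminating `m`, `u` and `u'` leaves a balance between the slacks `a`, `a'` and the rounding
  -- remainders.
  have hloss : 3 * c + 3 * x + a + e + y = 3 * x' + a' + e' + y' := by omega
  rcases Nat.even_or_odd' n with ⟨q, rfl | rfl⟩
  · omega
  -- For odd `n`, `a + e` is odd. Were the bound false, `hloss` would read `3 * c + 3 * x + 1 = 3 *
  -- x'`, impossible modulo 3.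
  · have hcase : 3 ≤ 2 * (a' + e' + y') + (a + e + y) + 3 * y := by
      by_contra hlt
      have : a' + e' + y' = 0 := by omega
      have : y = 0 := by omega
      have : a + e = 1 := by omega
      omega
    -- Parity: the two sides of `hp` cannot be equal.
    have hp' : 2 * m + 2 * p + 1 ≤ 3 * (2 * q + 1) + 2 * u := by omega
    have : (2 * q + 1) % 2 = 1 := by omega
    omega

/-- If every leaf of the tree of height `j` can be reached, then the number `F` of pebbles and the
supply `s` at the root satisfy `3 F + 2 s ≥ 2 ^ (j + 1) + max D (2 β)`, where `D` is the number of
pebbles that can be collected at the root and `β` is the number of binary ones of `⌊F / 2⌋`. -/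
theorem le_three_mul_total {j s : ℕ} {f : List Bool → ℕ}
    (hf : ∀ v : List Bool, v.length = j → 1 ≤ reach v j s f) :
    2 * 2 ^ j + collect j f ≤ 3 * total j f + 2 * s ∧
      2 * 2 ^ j + 2 * bitCount (total j f / 2) ≤ 3 * total j f + 2 * s := by
  induction j generalizing s f with
  | zero =>
    have h := hf [] rfl
    have h' := bitCount_add_le 0 (f [] / 2)
    simp only [reach, collect, total, zero_add] at h h' ⊢
    simp only [show bitCount 0 = 0 by simp [bitCount]] at h'
    omega
  | succ j ih =>
    have hL := ih (f := fun l => f (false :: l)) fun v hv => hf (false :: v) (by simp [hv])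
    have hR := ih (f := fun l => f (true :: l)) fun v hv => hf (true :: v) (by simp [hv])
    simp only [Bool.not_false, Bool.not_true] at hL hR
    simp only [collect, total, pow_succ]
    generalize collect j (fun l => f (false :: l)) = dL at *
    generalize collect j (fun l => f (true :: l)) = dR at *
    generalize total j (fun l => f (false :: l)) = nL at *
    generalize total j (fun l => f (true :: l)) = nR at *
    generalize 2 ^ j = m at *
    generalize f [] = r at *
    refine ⟨by omega, ?_⟩
    -- Half the total is the smaller count `n` plus half the excess, and each unit added creates at
    -- most one new binary one.
    have key (n n' : ℕ) (hn : n ≤ n') : bitCount ((r + n + n') / 2) ≤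
        bitCount (n / 2) + n % 2 + (r + n' - n) / 2 := by
      have h := bitCount_add_le n ((r + n' - n) / 2)
      rw [bitCount_div_two n, show n + (r + n' - n) / 2 = (r + n + n') / 2 by omega] at h
      omega
    rcases le_total nL nR with hle | hle
    · have := key nL nR hle
      have := join_subtrees hle hL.1 hR.1 hL.2
      omega
    · have := key nR nL hle
      have := join_subtrees hle hR.1 hL.1 hR.2
      rw [show r + nR + nL = r + nL + nR by omega] at *
      omega

/-! ### From the tree to binary words -/

/-- A configuration on the complete binary tree, extended by zero to all binary words. -/
def extend {h : ℕ} (f : TreeVertex h → ℕ) (l : List Bool) : ℕ :=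
  if hl : l.length ≤ h then f ⟨l, hl⟩ else 0

theorem extend_val {h : ℕ} (f : TreeVertex h → ℕ) (v : TreeVertex h) :
    extend f v.val = f v := dif_pos v.property

theorem wordMove_extend {h : ℕ} {f g : TreeVertex h → ℕ}
    (hm : Move (completeBinaryTree h) f g) : WordMove h (extend f) (extend g) := by
  obtain ⟨u, v, hadj, hu, hv, hrest⟩ := hm
  have hoff (w : List Bool) (h1 : w ≠ u.val) (h2 : w ≠ v.val) : extend g w = extend f w := by
    unfold extend
    split_ifs with hw
    · exact hrest _ (fun e => h1 (congrArg Subtype.val e)) (fun e => h2 (congrArg Subtype.val e))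
    · rfl
  rw [← extend_val f, ← extend_val g] at hu hv
  rcases hadj with ⟨b, hb⟩ | ⟨b, hb⟩
  · have hlen := v.property
    rw [hb, List.length_append, List.length_singleton] at hlen
    rw [hb] at hv hoff
    exact ⟨u.val, b, hlen, Or.inl ⟨hu, hv⟩, hoff⟩
  · have hlen := u.property
    rw [hb, List.length_append, List.length_singleton] at hlen
    rw [hb] at hu hoff
    exact ⟨v.val, b, hlen, Or.inr ⟨hu, hv⟩, fun w h1 h2 => hoff w h2 h1⟩

/-- A vertex of the tree of height `h + 1` is the root or lies below one of the two children. -/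
def treeVertexSuccEquiv (h : ℕ) : TreeVertex (h + 1) ≃ Option (Bool × TreeVertex h) where
  toFun v := match v with
    | ⟨[], _⟩ => none
    | ⟨b :: l, hl⟩ => some (b, ⟨l, by simpa using hl⟩)
  invFun o := match o with
    | none => ⟨[], by simp⟩
    | some (b, l) => ⟨b :: l.val, by simpa using l.property⟩
  left_inv v := by
    obtain ⟨_ | ⟨b, l⟩, hl⟩ := v <;> rfl
  right_inv o := by
    obtain _ | ⟨b, l⟩ := o <;> rfl

theorem sum_treeVertex (h : ℕ) (f : List Bool → ℕ) :
    ∑ v : TreeVertex h, f v.val = total h f := by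
  induction h generalizing f with
  | zero =>
    have hv (v : TreeVertex 0) : v = ⟨[], by simp⟩ :=
      Subtype.ext (List.eq_nil_of_length_eq_zero (Nat.le_zero.mp v.property))
    exact Fintype.sum_eq_single _ fun v hne => absurd (hv v) hne
  | succ h ih =>
    rw [← (treeVertexSuccEquiv h).symm.sum_comp, Fintype.sum_option, Fintype.sum_prod_type,
      Fintype.sum_bool]
    simp only [total, ← ih]
    rw [add_assoc, add_comm (∑ v : TreeVertex h, f (false :: v.val))]
    rfl

theorem le_three_mul_sum_of_pebbles {h : ℕ} {f : TreeVertex h → ℕ}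
    (hf : Pebbles (completeBinaryTree h) f) :
    2 * 2 ^ h + 2 * bitCount ((∑ v, f v) / 2) ≤ 3 * ∑ v, f v := by
  have hsum : ∑ v, f v = total h (extend f) := by
    simp only [← sum_treeVertex, extend_val]
  rw [hsum]
  refine (le_three_mul_total (s := 0) fun v hv => ?_).2
  obtain ⟨g, hfg, hg⟩ := hf ⟨v, hv.le⟩
  have hmono : reach v h 0 (extend g) ≤ reach v h 0 (extend f) := by
    clear hg
    induction hfg with
    | refl => exact le_rfl
    | tail _ hstep ih => exact ((wordMove_extend hstep).reach_le v 0).trans ih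
  have hle := le_reach v 0 (extend g) hv.le
  rw [show extend g v = g ⟨v, hv.le⟩ from dif_pos _] at hle
  omega

end Pebbling

theorem theorem4p1 (h : ℕ) (hh : 0 < h) :
    (2 : ℤ) ^ h - (Pebbling.kNumber h : ℤ) ≤
      (Pebbling.optimalPebblingNumber (Pebbling.completeBinaryTree h) : ℤ) := by
  obtain ⟨f, hsum, hf⟩ := Nat.sInf_mem
    (s := {p : ℕ | ∃ f : Pebbling.TreeVertex h → ℕ, ∑ v, f v = p ∧
      Pebbling.Pebbles (Pebbling.completeBinaryTree h) f})
    ⟨_, fun _ => 1, rfl, fun _ => ⟨_, Relation.ReflTransGen.refl, le_rfl⟩⟩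
  have hbound := Pebbling.le_three_mul_sum_of_pebbles hf
  rw [hsum] at hbound
  change _ + 2 * Pebbling.bitCount (Pebbling.optimalPebblingNumber _ / 2) ≤
    3 * Pebbling.optimalPebblingNumber _ at hbound
  generalize Pebbling.optimalPebblingNumber (Pebbling.completeBinaryTree h) = n at hbound ⊢
  suffices hk : 2 ^ h - n ≤ Pebbling.kNumber h by
    have : (2 : ℤ) ^ h = ((2 ^ h : ℕ) : ℤ) := by push_cast; rfl
    omega
  refine (Pebbling.isGreatest_kNumber h).2 ?_
  rcases le_or_gt (2 ^ h) n with hn | hn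
  · rw [Nat.sub_eq_zero_of_le hn]
    simp [Pebbling.seqS, Pebbling.seqA]
  · have hS := Pebbling.seqS_le_of_bitCount_le (k := 2 ^ h - n)
      (b := (3 * n - 2 * 2 ^ h) / 2)
      (by rw [show 2 ^ h - n + (3 * n - 2 * 2 ^ h) / 2 = n / 2 by omega]; omega)
    exact hS.trans (by omega)
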